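/- \textbf{Theorem.} Fix an integer $C\ge 1$ and real constants $a,b\ge 0$ and $s_1,s_2\in[0,1]$. For every $n$ divisible by $C$, let $[n]=\{1,\dots,n\}$ be partitioned into $C$ communities of equal size, with label map $\mathcal C:[n]\to[C]$, and let $p=\frac{a\log n}{n}$, $q=\frac{b\log n}{n}$ (natural logarithm; $n$ is taken large enough that $p,q\le 1$). Let $G$ be the random graph on $[n]$ in which distinct pairs $\{i,j\}$ are edges independently, with probability $p$ if $\mathcal C(i)=\mathcal C(j)$ and probability $q$ otherwise. Let $G_1$ be obtained from $G$ by keeping each edge independently with probability $s_1$, and $G_2$ by keeping each edge of $G$ independently with probability $s_2$, independently of the choices made for $G_1$. Let $\pi$ be a uniformly random permutation of $[n]$, independent of $(G,G_1,G_2)$, and let $\pi(G_2)$ be the graph with edges $\{\pi(i),\pi(j)\}$ for $\{i,j\}\in E(G_2)$, so that its vertex $\pi(i)$ has community label $\mathcal C(i)$. If $$\frac{(a+(C-1)b)\,s_1s_2}{C}>2,$$ then there is an algorithm (a computable function) which, given $G_1$, $\pi(G_2)$, the label map $\mathcal C$ of the vertices of $G_1$ and the label map $\mathcal C\circ\pi^{-1}$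 of the vertices of $\pi(G_2)$, outputs exactly $\pi$ with probability $1-o(1)$ as $n\to\infty$, uniformly over the choice of the equal-size partition. -/

import Mathlib

open Filter

/-- Unordered pairs of distinct vertices of `[n]`. -/
abbrev VertexPair (n : ℕ) : Type := {e : Sym2 (Fin n) // ¬ e.IsDiag}

/-- The graph on `[n]` whose edges are exactly the pairs `e` with `x e = true`. -/
def graphOf {n : ℕ} (x : VertexPair n → Bool) : SimpleGraph (Fin n) :=
  SimpleGraph.fromEdgeSet {e | ∃ h : ¬ e.IsDiag, x ⟨e, h⟩ = true}

/-- Probability mass function of a Bernoulli random bit with success probability `p`. -/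
def bernoulliMass (p : ℝ) (x : Bool) : ℝ := if x = true then p else 1 - p

/-- Edge probability of the planted partition model: `p` for two vertices with the same community
label and `q` for two vertices with different labels. -/
noncomputable def edgeProb {n C : ℕ} (p q : ℝ) (label : Fin n → Fin C) (e : VertexPair n) : ℝ :=
  open Classical in if (Sym2.map label e.1).IsDiag then p else q

/-- The `C` communities given by the labelling have the same number of vertices. -/
def EquallySized {n C : ℕ} (label : Fin n → Fin C) : Prop :=
  ∀ k k' : Fin C, Nat.card {i // label i = k} = Nat.card {i // label i = k'}

/-- The random bits that generate a pair of correlated graphs: for every pair of vertices, whether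
it is an edge of the underlying graph `G`, and whether the first (second) subsampling keeps it. -/
structure Bits (n : ℕ) where
  edge : VertexPair n → Bool
  keep₁ : VertexPair n → Bool
  keep₂ : VertexPair n → Bool

namespace Bits

variable {n : ℕ}

/-- `Bits n` as a product type, which makes it a finite type. -/
def equivProd (n : ℕ) :
    Bits n ≃ (VertexPair n → Bool) × (VertexPair n → Bool) × (VertexPair n → Bool) where
  toFun ω := (ω.edge, ω.keep₁, ω.keep₂)
  invFun t := ⟨t.1, t.2.1, t.2.2⟩
  left_inv _ := rfl
  right_inv _ := rfl

noncomputable instance : Fintype (Bits n) :=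
  open Classical in Fintype.ofEquiv _ (equivProd n).symm

/-- The underlying graph. -/
def G (ω : Bits n) : SimpleGraph (Fin n) := graphOf ω.edge

/-- The first subsampled graph: the edges of `G` that are kept by the first subsampling. -/
def G₁ (ω : Bits n) : SimpleGraph (Fin n) := graphOf fun e => ω.edge e && ω.keep₁ e

/-- The second subsampled graph: the edges of `G` that are kept by the second subsampling. -/
def G₂ (ω : Bits n) : SimpleGraph (Fin n) := graphOf fun e => ω.edge e && ω.keep₂ e

/-- The probability of `ω` when all bits are independent, `G` is a planted partition graph with
edge probabilities `p` and `q`, and the subsamplings keep an edge with probability `s₁`, `s₂`.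
(These are probabilities when `p, q, s₁, s₂` lie in `[0, 1]`.) -/
noncomputable def mass {C : ℕ} (p q s₁ s₂ : ℝ) (label : Fin n → Fin C) (ω : Bits n) : ℝ :=
  ∏ e : VertexPair n, bernoulliMass (edgeProb p q label e) (ω.edge e) *
    bernoulliMass s₁ (ω.keep₁ e) * bernoulliMass s₂ (ω.keep₂ e)

end Bits

/-- A graph on `[n]` written as its adjacency matrix, row by row. -/
noncomputable def graphCode {n : ℕ} (G : SimpleGraph (Fin n)) : List (List Bool) :=
  open Classical in List.ofFn fun i => List.ofFn fun j => decide (G.Adj i j)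

/-- A function `[n] → [k]` written as its list of values. -/
def funCode {n k : ℕ} (f : Fin n → Fin k) : List ℕ := List.ofFn fun i => (f i : ℕ)

/-- What the adversary sees, in this order: `G₁`, the anonymized graph `π(G₂)`, the community
labels of the vertices of `G₁`, and those of the vertices of `π(G₂)` (the vertex `π i` of `π(G₂)`
carries the label of `i`). -/
noncomputable def observation {n C : ℕ} (G₁ G₂ : SimpleGraph (Fin n)) (label : Fin n → Fin C)
    (π : Equiv.Perm (Fin n)) : List (List Bool) × List (List Bool) × List ℕ × List ℕ :=
  (graphCode G₁, graphCode (G₂.map π.toEmbedding), funCode label, funCode (label ∘ π.symm))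

/-- The probability that `A` outputs exactly `π`, where `π` is a uniformly random permutation of
`[n]`, independent of the correlated graphs `G₁` and `G₂`. -/
noncomputable def recoveryProb {n C : ℕ}
    (A : List (List Bool) × List (List Bool) × List ℕ × List ℕ → List ℕ)
    (p q s₁ s₂ : ℝ) (label : Fin n → Fin C) : ℝ :=
  ∑ ω : Bits n, ∑ π : Equiv.Perm (Fin n),
    ω.mass p q s₁ s₂ label * (1 / (n.factorial : ℝ)) *
      (if A (observation ω.G₁ ω.G₂ label π) = funCode π then 1 else 0)

/-!
The labels are not needed. The algorithm searches exhaustively for a bijection of the vertices of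
the two graphs under which the graph of common edges has minimum degree at least `k = 31`. It is
primitive recursive (`computable_coreMatching`), and it outputs `π` as soon as `π` is the only such
bijection (`coreMatching_observation`).

The true matching qualifies: the degree of a vertex in `G₁ ∩ G₂` is a sum of independent bits with
mean at least `2 log n - a`, and Markov's inequality for `(1 / 4) ^ degree`
(`Bits.sum_mass_mul_degree_le`) bounds the probability that it is less than `k` by a constant times
`n ^ (-3 / 2)`, which survives the union bound over the vertices.

A false matching differs from `π` by a permutation `τ ≠ 1` whose support has `d` elements. If it
qualifies, then at least `(k - 1) d / 2 = 15 d` pairs `e` meet the support, satisfy `τ e ≠ e`, and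
have both `e` and `τ e` among the edges of the underlying graph. Among them are `5 d` pairs forming
a set `S` disjoint from `τ S` (`exists_witnessSet`). The bits of `S ∪ τ S` are independent, so they
are all edges with probability at most `P ^ (10 d)`, where `P = (a + b) log n / n`. Since `S` is a
set of `5 d` among at most `d n` pairs, it can be chosen in at most `n ^ (6 d)` ways
(`card_witnessSets_le`), and `τ` in at most `n ^ (2 d)` ways (`card_perm_card_support_le`). As
`n ^ 8 * P ^ 10` is of order `log n ^ 10 / n ^ 2`, the sum over all `τ` tends to `0`.
-/

/-! ### The matching algorithm -/

/-- The type of the data seen by the adversary: two adjacency matrices and two lists of labels. -/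
abbrev ObservationCode : Type := List (List Bool) × List (List Bool) × List ℕ × List ℕ

/-- The entry `(i, j)` of a matrix written row by row, `false` outside its range. -/
def matrixEntry (M : List (List Bool)) (i j : ℕ) : Bool := (M.getD i []).getD j false

/-- All words of length `m` over the alphabet `{0, …, n - 1}`. -/
def words (n m : ℕ) : List (List ℕ) :=
  Nat.rec [[]] (fun _ W => (List.range n).flatMap fun x => W.map fun w => x :: w) m

/-- `{i, j}` is an edge of the first graph whose image under the map coded by the word `y.1` is an
edge of the second graph; here `y.2` is an observation. -/
def IsCommonEdge (j : ℕ) (y : ℕ × List ℕ × ObservationCode) : Prop :=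
  matrixEntry y.2.2.1 y.1 j = true ∧
    matrixEntry y.2.2.2.1 (y.2.1.getD y.1 0) (y.2.1.getD j 0) = true

instance (j : ℕ) (y : ℕ × List ℕ × ObservationCode) : Decidable (IsCommonEdge j y) :=
  inferInstanceAs (Decidable (_ ∧ _))

/-- The word `w` codes an injective map of the vertices such that every vertex has degree at least
`k` in the graph of common edges. -/
def IsCoreMatching (k : ℕ) (w : List ℕ) (o : ObservationCode) : Prop :=
  (∀ i < o.1.length, ∀ j < o.1.length, w.getD i 0 = w.getD j 0 → i = j) ∧
    ∀ i < o.1.length, k ≤ ((List.range o.1.length).filter fun j => IsCommonEdge j (i, w, o)).length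

instance (k : ℕ) (w : List ℕ) (o : ObservationCode) : Decidable (IsCoreMatching k w o) :=
  inferInstanceAs (Decidable (_ ∧ _))

/-- The exhaustive search for a bijection of the vertices under which the graph of common edges has
minimum degree at least `k`. The community labels are ignored. -/
def coreMatching (k : ℕ) (o : ObservationCode) : List ℕ :=
  ((words o.1.length o.1.length).filter fun w => IsCoreMatching k w o).headI

theorem primrec_words : Primrec₂ words := by
  have h1 : Primrec₂ fun (n : ℕ) (p : ℕ × List (List ℕ)) =>
      (List.range n).flatMap fun x => p.2.map fun w => x :: w := by
    refine Primrec.list_flatMap (Primrec.list_range.comp Primrec.fst) ?_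
    refine Primrec.list_map (Primrec.snd.comp (Primrec.snd.comp Primrec.fst)) ?_
    exact Primrec.list_cons.comp (Primrec.snd.comp Primrec.fst) Primrec.snd
  exact Primrec.nat_rec (Primrec.const [[]]) h1

theorem primrec_matrixEntry {α : Type*} [Primcodable α] {M : α → List (List Bool)} {f g : α → ℕ}
    (hM : Primrec M) (hf : Primrec f) (hg : Primrec g) :
    Primrec fun x => matrixEntry (M x) (f x) (g x) :=
  (Primrec.list_getD false).comp ((Primrec.list_getD []).comp hM hf) hg

theorem primrecPred_forall_lt {α : Type*} [Primcodable α] {R : ℕ → α → Prop} {g : α → ℕ}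
    (hR : PrimrecRel R) (hg : Primrec g) : PrimrecPred fun a => ∀ i < g a, R i a :=
  (PrimrecRel.comp hR.forall_mem_list (Primrec.list_range.comp hg) Primrec.id).of_eq fun a => by
    simp only [List.mem_range, id]

theorem primrecRel_isCommonEdge : PrimrecRel IsCommonEdge := by
  have hj : Primrec fun p : ℕ × (ℕ × List ℕ × ObservationCode) => p.1 := Primrec.fst
  have hi : Primrec fun p : ℕ × (ℕ × List ℕ × ObservationCode) => p.2.1 :=
    Primrec.fst.comp Primrec.snd
  have hw : Primrec fun p : ℕ × (ℕ × List ℕ × ObservationCode) => p.2.2.1 :=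
    Primrec.fst.comp (Primrec.snd.comp Primrec.snd)
  have ho : Primrec fun p : ℕ × (ℕ × List ℕ × ObservationCode) => p.2.2.2 :=
    Primrec.snd.comp (Primrec.snd.comp Primrec.snd)
  refine PrimrecPred.and ?_ ?_
  · exact Primrec.eq.comp (primrec_matrixEntry (Primrec.fst.comp ho) hi hj) (Primrec.const true)
  · exact Primrec.eq.comp (primrec_matrixEntry (Primrec.fst.comp (Primrec.snd.comp ho))
      ((Primrec.list_getD 0).comp hw hi) ((Primrec.list_getD 0).comp hw hj)) (Primrec.const true)

theorem primrecRel_isCoreMatching (k : ℕ) : PrimrecRel (IsCoreMatching k) := by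
  have hn : Primrec fun p : List ℕ × ObservationCode => p.2.1.length :=
    Primrec.list_length.comp (Primrec.fst.comp Primrec.snd)
  refine PrimrecPred.and ?_ ?_
  · -- the word is injective on the vertices
    have h0 : PrimrecRel fun (j : ℕ) (y : ℕ × List ℕ × ObservationCode) =>
        y.2.1.getD y.1 0 = y.2.1.getD j 0 → y.1 = j := by
      have hj : Primrec fun p : ℕ × (ℕ × List ℕ × ObservationCode) => p.1 := Primrec.fst
      have hi : Primrec fun p : ℕ × (ℕ × List ℕ × ObservationCode) => p.2.1 :=
        Primrec.fst.comp Primrec.snd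
      have hw : Primrec fun p : ℕ × (ℕ × List ℕ × ObservationCode) => p.2.2.1 :=
        Primrec.fst.comp (Primrec.snd.comp Primrec.snd)
      have e1 : PrimrecPred fun p : ℕ × (ℕ × List ℕ × ObservationCode) =>
          p.2.2.1.getD p.2.1 0 = p.2.2.1.getD p.1 0 :=
        Primrec.eq.comp ((Primrec.list_getD 0).comp hw hi) ((Primrec.list_getD 0).comp hw hj)
      have e2 : PrimrecPred fun p : ℕ × (ℕ × List ℕ × ObservationCode) => p.2.1 = p.1 :=
        Primrec.eq.comp hi hj
      exact (e1.not.or e2).of_eq fun p => imp_iff_not_or.symm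
    have h1 : PrimrecRel fun (i : ℕ) (y : List ℕ × ObservationCode) =>
        ∀ j < y.2.1.length, y.1.getD i 0 = y.1.getD j 0 → i = j :=
      primrecPred_forall_lt h0 (hn.comp Primrec.snd)
    exact primrecPred_forall_lt h1 hn
  · have h0 : PrimrecRel fun (i : ℕ) (y : List ℕ × ObservationCode) =>
        k ≤ ((List.range y.2.1.length).filter fun j => IsCommonEdge j (i, y)).length :=
      Primrec.nat_le.comp (Primrec.const k) (Primrec.list_length.comp
        (primrecRel_isCommonEdge.listFilter.comp
          (Primrec.list_range.comp (hn.comp Primrec.snd)) Primrec.id))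
    exact primrecPred_forall_lt h0 hn

theorem computable_coreMatching (k : ℕ) : Computable (coreMatching k) := by
  have hn : Primrec fun o : ObservationCode => o.1.length := Primrec.list_length.comp Primrec.fst
  exact (Primrec.list_headI.comp ((primrecRel_isCoreMatching k).listFilter.comp
    (primrec_words.comp hn hn) Primrec.id)).to_comp

theorem mem_words {n m : ℕ} {w : List ℕ} :
    w ∈ words n m ↔ w.length = m ∧ ∀ x ∈ w, x < n := by
  induction m generalizing w with
  | zero =>
    change w ∈ [[]] ↔ _
    simp only [List.mem_singleton, List.length_eq_zero_iff]
    constructor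
    · rintro rfl; simp
    · exact fun h => h.1
  | succ m ih =>
    change w ∈ ((List.range n).flatMap fun x => (words n m).map fun w => x :: w) ↔ _
    simp only [List.mem_flatMap, List.mem_range, List.mem_map, ih]
    constructor
    · rintro ⟨x, hx, v, ⟨hv, hv'⟩, rfl⟩
      simp [hv, hx]
      exact hv'
    · rintro ⟨h1, h2⟩
      cases w with
      | nil => simp at h1
      | cons x v =>
        refine ⟨x, h2 x (by simp), v, ⟨by simpa using h1, fun y hy => h2 y (by simp [hy])⟩, rfl⟩

theorem funCode_getD {n k : ℕ} (f : Fin n → Fin k) (i : Fin n) :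
    (funCode f).getD i 0 = f i := by
  simp [funCode, List.getD]

theorem matrixEntry_graphCode {n : ℕ} (G : SimpleGraph (Fin n)) (i j : Fin n) :
    matrixEntry (graphCode G) i j = true ↔ G.Adj i j := by
  simp [matrixEntry, graphCode, List.getD]

theorem funCode_mem_words {n : ℕ} (f : Fin n → Fin n) : funCode f ∈ words n n := by
  rw [mem_words]
  simp [funCode, List.mem_ofFn]

theorem exists_funCode_of_mem_words {n : ℕ} {w : List ℕ} (hw : w ∈ words n n) :
    ∃ f : Fin n → Fin n, w = funCode f := by
  rw [mem_words] at hw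
  obtain ⟨h1, h2⟩ := hw
  refine ⟨fun i => ⟨w[i]'(by omega), h2 _ (List.getElem_mem _)⟩, ?_⟩
  apply List.ext_getElem
  · simp [funCode, h1]
  · intro i h h'
    simp [funCode]

open Classical in
/-- The neighbours of `v` in the graph of those edges of `G₁` which the relabelling `τ` maps to
edges of `G₂`. -/
noncomputable def commonNeighbors {n : ℕ} (G₁ G₂ : SimpleGraph (Fin n)) (τ : Fin n → Fin n)
    (v : Fin n) : Finset (Fin n) :=
  Finset.univ.filter fun u => G₁.Adj v u ∧ G₂.Adj (τ v) (τ u)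

theorem length_filter_range_eq_card {n : ℕ} (p : ℕ → Prop) [DecidablePred p] :
    ((List.range n).filter fun j => p j).length =
      (Finset.univ.filter fun j : Fin n => p j).card := by
  have h : (Finset.univ.filter fun j : Fin n => p j).map Fin.valEmbedding =
      (Finset.range n).filter p := by
    ext x
    simp only [Finset.mem_map, Finset.mem_filter, Finset.mem_univ, true_and, Finset.mem_range,
      Fin.valEmbedding_apply]
    exact ⟨fun ⟨j, hj, hjx⟩ => hjx ▸ ⟨j.2, hj⟩, fun ⟨hx, hp⟩ => ⟨⟨x, hx⟩, hp, rfl⟩⟩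
  rw [← Finset.card_map, h]
  rfl

theorem isCoreMatching_funCode {n : ℕ} (k : ℕ) (H₁ H₂ : SimpleGraph (Fin n)) (l l' : List ℕ)
    (f : Fin n → Fin n) :
    IsCoreMatching k (funCode f) (graphCode H₁, graphCode H₂, l, l') ↔
      Function.Injective f ∧ ∀ v, k ≤ (commonNeighbors H₁ H₂ f v).card := by
  have hlen : (graphCode H₁).length = n := by simp [graphCode]
  unfold IsCoreMatching
  simp only [hlen]
  refine and_congr ?_ ?_
  · constructor
    · intro h i j hij
      refine Fin.ext (h i i.2 j j.2 ?_)
      rw [funCode_getD, funCode_getD, hij]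
    · intro h i hi j hj hij
      have h1 := funCode_getD f ⟨i, hi⟩
      have h2 := funCode_getD f ⟨j, hj⟩
      simp only at h1 h2
      rw [h1, h2] at hij
      exact congrArg Fin.val (h (Fin.ext hij))
  · have key : ∀ v : Fin n, ((List.range n).filter fun j => IsCommonEdge j
        ((v : ℕ), funCode f, (graphCode H₁, graphCode H₂, l, l'))).length =
        (commonNeighbors H₁ H₂ f v).card := by
      intro v
      rw [length_filter_range_eq_card, commonNeighbors]
      congr 1
      ext u
      simp only [Finset.mem_filter, Finset.mem_univ, true_and, IsCommonEdge, funCode_getD]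
      rw [matrixEntry_graphCode, matrixEntry_graphCode]
    constructor
    · intro h v
      rw [← key]
      exact h v v.2
    · intro h i hi
      have := h ⟨i, hi⟩
      rwa [← key] at this

/-- A bijection `σ` from the vertices of `G₁` to those of `π(G₂)` has the same common edges as
the relabelling `π⁻¹ σ` has between `G₁` and `G₂`; so the search succeeds when `τ = 1` is the only
relabelling with minimum common degree at least `k`. -/
theorem coreMatching_observation {n C : ℕ} {k : ℕ} {G₁ G₂ : SimpleGraph (Fin n)}
    (label : Fin n → Fin C) (π : Equiv.Perm (Fin n))
    (hmin : ∀ v, k ≤ (commonNeighbors G₁ G₂ id v).card)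
    (hfalse : ∀ τ : Equiv.Perm (Fin n), τ ≠ 1 → ∃ v, (commonNeighbors G₁ G₂ τ v).card < k) :
    coreMatching k (observation G₁ G₂ label π) = funCode π := by
  have hlen : (graphCode G₁).length = n := by simp [graphCode]
  have hcommon : ∀ (f : Fin n → Fin n) (v : Fin n),
      commonNeighbors G₁ (G₂.map π.toEmbedding) f v = commonNeighbors G₁ G₂ (π.symm ∘ f) v := by
    intro f v
    ext u
    simp only [commonNeighbors, Finset.mem_filter, Finset.mem_univ, true_and, Function.comp]
    have h := SimpleGraph.map_adj_apply (G := G₂) (f := π.toEmbedding)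
      (a := π.symm (f v)) (b := π.symm (f u))
    rw [← h]
    simp only [Equiv.coe_toEmbedding, Equiv.apply_symm_apply]
  set L := (words n n).filter fun w => IsCoreMatching k w (observation G₁ G₂ label π) with hL
  have hmem : funCode π ∈ L := by
    rw [hL, List.mem_filter]
    refine ⟨funCode_mem_words _, decide_eq_true ?_⟩
    rw [observation, isCoreMatching_funCode]
    refine ⟨π.injective, fun v => ?_⟩
    rw [hcommon, Equiv.symm_comp_self]
    exact hmin v
  have huniq : ∀ w ∈ L, w = funCode π := by
    intro w hw
    rw [hL, List.mem_filter] at hw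
    obtain ⟨hw1, hw2⟩ := hw
    obtain ⟨f, rfl⟩ := exists_funCode_of_mem_words hw1
    have hw3 := of_decide_eq_true hw2
    rw [observation, isCoreMatching_funCode] at hw3
    obtain ⟨hinj, hdeg⟩ := hw3
    by_contra hne
    have hbij : Function.Bijective f := Finite.injective_iff_bijective.mp hinj
    obtain ⟨v, hv⟩ := hfalse ((Equiv.ofBijective f hbij).trans π.symm) (by
      intro h
      apply hne
      congr 1
      funext i
      have := congrArg (fun τ : Equiv.Perm (Fin n) => π (τ i)) h
      simpa using this)
    have h1 := hdeg v
    rw [hcommon] at h1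
    exact absurd h1 (not_le.mpr hv)
  have hdef : coreMatching k (observation G₁ G₂ label π) = L.headI := by
    simp only [coreMatching, hL]
    rw [show (observation G₁ G₂ label π).1.length = n from hlen]
  rw [hdef]
  cases hLL : L with
  | nil => rw [hLL] at hmem; simp at hmem
  | cons x t => exact huniq x (by rw [hLL]; simp)

/-! ### Combinatorics of false matchings -/

/-- The action of a permutation of the vertices on unordered pairs of distinct vertices. -/
def pairPerm {n : ℕ} (τ : Equiv.Perm (Fin n)) (e : VertexPair n) : VertexPair n :=
  ⟨Sym2.map τ e.1, by rw [Sym2.isDiag_map τ.injective]; exact e.2⟩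

theorem pairPerm_injective {n : ℕ} (τ : Equiv.Perm (Fin n)) :
    Function.Injective (pairPerm τ) := fun _ _ h =>
  Subtype.ext (Sym2.map.injective τ.injective (congrArg Subtype.val h))

open Classical in
/-- The pairs that contain at least one vertex of `T`. -/
noncomputable def pairsMeeting {n : ℕ} (T : Finset (Fin n)) : Finset (VertexPair n) :=
  Finset.univ.filter fun e => ∃ v ∈ T, v ∈ e.1

theorem card_pairsMeeting_le {n : ℕ} (T : Finset (Fin n)) :
    (pairsMeeting T).card ≤ T.card * n := by
  classical
  have h : (pairsMeeting T).map (Function.Embedding.subtype _) ⊆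
      (T ×ˢ (Finset.univ : Finset (Fin n))).image fun x => s(x.1, x.2) := by
    intro e he
    simp only [pairsMeeting, Finset.mem_map, Finset.mem_filter, Finset.mem_univ, true_and,
      Function.Embedding.subtype_apply] at he
    obtain ⟨e, ⟨v, hv, hve⟩, rfl⟩ := he
    obtain ⟨u, hu⟩ := hve
    rw [Finset.mem_image]
    exact ⟨(v, u), by simp [hv], hu.symm⟩
  calc (pairsMeeting T).card = ((pairsMeeting T).map (Function.Embedding.subtype _)).card := by
        rw [Finset.card_map]
    _ ≤ _ := Finset.card_le_card h
    _ ≤ _ := Finset.card_image_le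
    _ = T.card * n := by simp

/-- An injective map without fixed points on `B` has a subset of `B` of a third of its size that is
disjoint from its image: in a maximal one, every point of `B` lies in the set, in its image or in
its preimage. -/
theorem exists_disjoint_image {α : Type*} [DecidableEq α] {f : α → α}
    (hf : Function.Injective f) (B : Finset α) (hB : ∀ e ∈ B, f e ≠ e) :
    ∃ S ⊆ B, Disjoint S (S.image f) ∧ B.card ≤ 3 * S.card := by
  obtain ⟨S, hS, hmax⟩ := Finset.exists_max_image
    (B.powerset.filter fun S => Disjoint S (S.image f)) Finset.card ⟨∅, by simp⟩
  simp only [Finset.mem_filter, Finset.mem_powerset] at hS hmax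
  refine ⟨S, hS.1, hS.2, ?_⟩
  have hcover : B ⊆ S ∪ (S.image f ∪ B.filter fun e => f e ∈ S) := by
    intro e he
    by_contra hne
    simp only [Finset.mem_union, Finset.mem_filter, not_or, not_and] at hne
    obtain ⟨h1, h2, h3⟩ := hne
    have hins : Disjoint (insert e S) ((insert e S).image f) := by
      rw [Finset.image_insert, Finset.disjoint_insert_left, Finset.disjoint_insert_right]
      refine ⟨?_, h3 he, hS.2⟩
      rw [Finset.mem_insert, not_or]
      exact ⟨fun h => hB e he h.symm, h2⟩
    have := hmax (insert e S) ⟨Finset.insert_subset he hS.1, hins⟩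
    rw [Finset.card_insert_of_notMem h1] at this
    omega
  have hpre : (B.filter fun e => f e ∈ S).card ≤ S.card := by
    refine Finset.card_le_card_of_injOn f (fun e he => ?_) hf.injOn
    exact (Finset.mem_filter.mp he).2
  have h1 := Finset.card_le_card hcover
  have h2 := Finset.card_union_le S (S.image f ∪ B.filter fun e => f e ∈ S)
  have h3 := Finset.card_union_le (S.image f) (B.filter fun e => f e ∈ S)
  have h4 : (S.image f).card ≤ S.card := Finset.card_image_le
  omega

theorem graphOf_adj {n : ℕ} {x : VertexPair n → Bool} {u v : Fin n} :
    (graphOf x).Adj u v ↔ ∃ h : ¬ (s(u, v)).IsDiag, x ⟨s(u, v), h⟩ = true := by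
  simp only [graphOf, SimpleGraph.fromEdgeSet_adj, Set.mem_ofPred_eq]
  exact ⟨fun h => h.1, fun h => ⟨h, fun huv => h.1 (Sym2.mk_isDiag_iff.mpr huv)⟩⟩

open Classical in
/-- The sets of `5 |supp τ|` pairs, each meeting the support of `τ`, that are disjoint from their
image under `τ`. -/
noncomputable def witnessSets {n : ℕ} (τ : Equiv.Perm (Fin n)) : Finset (Finset (VertexPair n)) :=
  ((pairsMeeting τ.support).powersetCard (5 * τ.support.card)).filter fun S =>
    Disjoint S (S.image (pairPerm τ))

/-- Double counting: if every vertex moved by `τ` has at least `31` common neighbours, then at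
least `15 |supp τ|` pairs which meet the support and are not fixed by `τ` are edges together with
their images; a third of them can be chosen disjoint from its image. -/
theorem exists_witnessSet {n : ℕ} (ω : Bits n) (τ : Equiv.Perm (Fin n))
    (h : ∀ v, 31 ≤ (commonNeighbors ω.G₁ ω.G₂ τ v).card) :
    ∃ S ∈ witnessSets τ, ∀ e ∈ S, ω.edge e = true ∧ ω.edge (pairPerm τ e) = true := by
  classical
  set B : Finset (VertexPair n) := (pairsMeeting τ.support).filter fun e =>
    pairPerm τ e ≠ e ∧ ω.edge e = true ∧ ω.edge (pairPerm τ e) = true with hBdef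
  have hdeg : ∀ v ∈ τ.support, 30 ≤ (B.filter fun e => v ∈ e.1).card := by
    intro v hv
    have hv' : τ v ≠ v := Equiv.Perm.mem_support.mp hv
    -- discarding the neighbour `τ v` leaves only pairs `s(v, u)` that `τ` does not fix
    have h30 : 30 ≤ ((commonNeighbors ω.G₁ ω.G₂ τ v).erase (τ v)).card :=
      le_trans (Nat.sub_le_sub_right (h v) 1) Finset.pred_card_le_card_erase
    refine h30.trans ?_
    rw [← Finset.card_map (Function.Embedding.subtype _) (s := B.filter _)]
    refine Finset.card_le_card_of_injOn (fun u => s(v, u)) ?_ ?_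
    · intro u hu
      simp only [commonNeighbors, Finset.coe_erase, Finset.coe_filter, Finset.mem_univ, true_and,
        Set.mem_sdiff, Set.mem_ofPred_eq, Set.mem_singleton_iff, Bits.G₁, Bits.G₂,
        graphOf_adj, Bool.and_eq_true] at hu
      obtain ⟨⟨⟨hd, h1, -⟩, ⟨hd', h2, -⟩⟩, hne⟩ := hu
      simp only [Finset.coe_map, Function.Embedding.subtype_apply, Set.mem_image, Finset.mem_coe,
        Finset.mem_filter]
      refine ⟨⟨s(v, u), hd⟩, ⟨?_, by simp⟩, rfl⟩
      rw [hBdef, Finset.mem_filter]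
      refine ⟨?_, ?_, h1, h2⟩
      · rw [pairsMeeting, Finset.mem_filter]
        exact ⟨Finset.mem_univ _, v, hv, by simp⟩
      · intro heq
        have : s(τ v, τ u) = s(v, u) := congrArg Subtype.val heq
        rw [Sym2.eq_iff] at this
        rcases this with h | h
        · exact hv' h.1
        · exact hne h.1.symm
    · intro u _ u' _ huu
      exact Sym2.congr_right.mp huu
  have hcount : τ.support.card * 30 ≤ B.card * 2 := by
    refine Finset.card_mul_le_card_mul (fun v e => v ∈ e.1) (fun v hv => ?_) (fun e _ => ?_)
    · exact hdeg v hv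
    · calc (Finset.bipartiteBelow (fun (v : Fin n) (e : VertexPair n) => v ∈ e.1) τ.support e).card
          ≤ e.1.toFinset.card := Finset.card_le_card fun v hv => by
            rw [Finset.mem_bipartiteBelow] at hv
            exact Sym2.mem_toFinset.mpr hv.2
        _ ≤ 2 := by rw [Sym2.card_toFinset]; split_ifs <;> omega
  obtain ⟨S, hSB, hSd, hcard⟩ := exists_disjoint_image (pairPerm_injective τ) B
    (fun e he => (Finset.mem_filter.mp he).2.1)
  obtain ⟨S', hS', hcard'⟩ := Finset.exists_subset_card_eq
    (show 5 * τ.support.card ≤ S.card by omega)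
  refine ⟨S', ?_, fun e he => (Finset.mem_filter.mp (hSB (hS' he))).2.2⟩
  rw [witnessSets, Finset.mem_filter, Finset.mem_powersetCard]
  refine ⟨⟨fun e he => (Finset.mem_filter.mp (hSB (hS' he))).1, hcard'⟩, ?_⟩
  exact Disjoint.mono hS' (Finset.image_subset_image hS') hSd

theorem card_witnessSets_le {n : ℕ} (τ : Equiv.Perm (Fin n)) :
    (witnessSets τ).card ≤ (n ^ 6) ^ τ.support.card := by
  set d := τ.support.card with hd
  have hdn : d ≤ n := by
    have := Finset.card_le_univ τ.support
    rwa [Fintype.card_fin] at this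
  rcases Nat.eq_zero_or_pos d with h0 | hpos
  · refine (Finset.card_filter_le _ _).trans ?_
    rw [Finset.card_powersetCard, ← hd, h0]
    simp
  have h1 : (witnessSets τ).card ≤ (d * n).choose (5 * d) := by
    refine (Finset.card_filter_le _ _).trans ?_
    rw [Finset.card_powersetCard]
    exact Nat.choose_le_choose _ (card_pairsMeeting_le _)
  have h2 : (5 * d).factorial * (d * n).choose (5 * d) ≤ (d * n) ^ (5 * d) := by
    rw [← Nat.descFactorial_eq_factorial_mul_choose]
    exact Nat.descFactorial_le_pow _ _
  have h3 : d ^ (4 * d) ≤ (5 * d).factorial := by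
    calc d ^ (4 * d) ≤ (d + 1) ^ (4 * d) := Nat.pow_le_pow_left (Nat.le_succ d) _
      _ ≤ d.factorial * (d + 1) ^ (4 * d) := Nat.le_mul_of_pos_left _ d.factorial_pos
      _ ≤ (d + 4 * d).factorial := Nat.factorial_mul_pow_le_factorial
      _ = (5 * d).factorial := by congr 1; ring
  -- the factor `d ^ (4 * d)` of `(d * n) ^ (5 * d)` is absorbed by the factorial
  have h4 : d ^ (4 * d) * (d * n).choose (5 * d) ≤ d ^ (4 * d) * (n ^ 6) ^ d := by
    calc d ^ (4 * d) * (d * n).choose (5 * d) ≤ (d * n) ^ (5 * d) :=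
          (Nat.mul_le_mul_right _ h3).trans h2
      _ = d ^ (4 * d) * (d ^ d * n ^ (5 * d)) := by rw [mul_pow]; ring
      _ ≤ d ^ (4 * d) * (n ^ d * n ^ (5 * d)) := by gcongr
      _ = d ^ (4 * d) * (n ^ 6) ^ d := by rw [← pow_mul, ← pow_add]; congr 2; ring
  exact h1.trans (Nat.le_of_mul_le_mul_left h4 (by positivity))

/-- A permutation is determined by its graph over its support, a set of `d` pairs of points when
the support has `d` elements. -/
theorem card_perm_card_support_le (n d : ℕ) :
    (Finset.univ.filter fun τ : Equiv.Perm (Fin n) => τ.support.card = d).card ≤ (n ^ 2) ^ d := by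
  have h : (Finset.univ.filter fun τ : Equiv.Perm (Fin n) => τ.support.card = d).card ≤
      ((Finset.univ : Finset (Fin n × Fin n)).powersetCard d).card := by
    refine Finset.card_le_card_of_injOn (fun τ => τ.support.image fun v => (v, τ v)) ?_ ?_
    · intro τ hτ
      simp only [Finset.coe_filter, Finset.mem_univ, true_and, Set.mem_ofPred_eq] at hτ
      rw [Finset.mem_coe, Finset.mem_powersetCard]
      refine ⟨Finset.subset_univ _, ?_⟩
      rw [Finset.card_image_of_injective _ fun u v huv => congrArg Prod.fst huv, hτ]
    · intro τ _ σ _ hτσ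
      have key : ∀ v w, (v, w) ∈ τ.support.image (fun v => (v, τ v)) ↔ τ v ≠ v ∧ τ v = w := by
        intro v w; simp
      have key' : ∀ v w, (v, w) ∈ σ.support.image (fun v => (v, σ v)) ↔ σ v ≠ v ∧ σ v = w := by
        intro v w; simp
      have hiff : ∀ v w, (τ v ≠ v ∧ τ v = w) ↔ (σ v ≠ v ∧ σ v = w) := by
        intro v w
        rw [← key, ← key']
        exact iff_of_eq (congrArg (fun F => (v, w) ∈ F) hτσ)
      ext v
      congr 1
      by_cases hv : τ v = v
      · by_contra hne
        have h1 : σ v ≠ v := fun h => hne (hv.trans h.symm)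
        exact ((hiff v (σ v)).mpr ⟨h1, rfl⟩).1 hv
      · exact (((hiff v (τ v)).mp ⟨hv, rfl⟩).2).symm
  refine h.trans ?_
  rw [Finset.card_powersetCard, Finset.card_univ, Fintype.card_prod, Fintype.card_fin, ← sq]
  exact Nat.choose_le_pow _ _

theorem sum_pow_card_support_le {n : ℕ} {x : ℝ} (hx : 0 ≤ x) (hx1 : (n : ℝ) ^ 2 * x ≤ 1) :
    ∑ τ ∈ (Finset.univ : Finset (Equiv.Perm (Fin n))).erase 1, x ^ τ.support.card ≤
      n * ((n : ℝ) ^ 2 * x) := by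
  have hmaps : ∀ τ ∈ (Finset.univ : Finset (Equiv.Perm (Fin n))).erase 1,
      τ.support.card ∈ Finset.Icc 1 n := by
    intro τ hτ
    have h1 : τ ≠ 1 := Finset.ne_of_mem_erase hτ
    have h2 := Finset.card_le_univ τ.support
    rw [Fintype.card_fin] at h2
    rw [Finset.mem_Icc]
    refine ⟨?_, h2⟩
    rw [Nat.one_le_iff_ne_zero, Ne, Finset.card_eq_zero, Equiv.Perm.support_eq_empty_iff]
    exact h1
  rw [← Finset.sum_fiberwise_of_maps_to hmaps]
  have hfib : ∀ d ∈ Finset.Icc 1 n,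
      ∑ τ ∈ ((Finset.univ : Finset (Equiv.Perm (Fin n))).erase 1).filter
        (fun τ => τ.support.card = d), x ^ τ.support.card ≤ (n : ℝ) ^ 2 * x := by
    intro d hd
    have hd1 : 1 ≤ d := (Finset.mem_Icc.mp hd).1
    have hcard : ((((Finset.univ : Finset (Equiv.Perm (Fin n))).erase 1).filter
        (fun τ => τ.support.card = d)).card : ℝ) ≤ ((n : ℝ) ^ 2) ^ d := by
      have := (Finset.card_le_card (Finset.filter_subset_filter
        (fun τ : Equiv.Perm (Fin n) => τ.support.card = d)
        (Finset.erase_subset 1 Finset.univ))).trans (card_perm_card_support_le n d)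
      exact_mod_cast this
    rw [Finset.sum_congr rfl fun τ hτ => congrArg (x ^ ·) (Finset.mem_filter.mp hτ).2,
      Finset.sum_const, nsmul_eq_mul]
    calc _ ≤ ((n : ℝ) ^ 2) ^ d * x ^ d := mul_le_mul_of_nonneg_right hcard (by positivity)
      _ = ((n : ℝ) ^ 2 * x) ^ d := by rw [mul_pow]
      _ ≤ (n : ℝ) ^ 2 * x := pow_le_of_le_one (by positivity) hx1 (by omega)
  calc _ ≤ ∑ _d ∈ Finset.Icc 1 n, ((n : ℝ) ^ 2 * x) := Finset.sum_le_sum hfib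
    _ = n * ((n : ℝ) ^ 2 * x) := by simp

/-! ### Probabilities of product events -/

theorem bernoulliMass_nonneg {p : ℝ} (hp : p ∈ Set.Icc (0 : ℝ) 1) (x : Bool) :
    0 ≤ bernoulliMass p x := by
  have := hp.1
  have := hp.2
  unfold bernoulliMass
  split_ifs <;> linarith

theorem edgeProb_mem {n C : ℕ} {p q : ℝ} {s : Set ℝ} (hp : p ∈ s) (hq : q ∈ s)
    (label : Fin n → Fin C) (e : VertexPair n) : edgeProb p q label e ∈ s := by
  unfold edgeProb
  split_ifs <;> assumption

theorem Bits.mass_nonneg {n C : ℕ} {p q s₁ s₂ : ℝ} (hp : p ∈ Set.Icc (0 : ℝ) 1)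
    (hq : q ∈ Set.Icc (0 : ℝ) 1) (hs₁ : s₁ ∈ Set.Icc (0 : ℝ) 1) (hs₂ : s₂ ∈ Set.Icc (0 : ℝ) 1)
    (label : Fin n → Fin C) (ω : Bits n) : 0 ≤ ω.mass p q s₁ s₂ label :=
  Finset.prod_nonneg fun e _ => mul_nonneg (mul_nonneg
    (bernoulliMass_nonneg (edgeProb_mem hp hq label e) _) (bernoulliMass_nonneg hs₁ _))
    (bernoulliMass_nonneg hs₂ _)

/-- Independence of the pairs: the expectation of a product of functions, each of the bits of one
pair, is the product of the expectations. -/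
theorem Bits.sum_mass_mul_prod {n C : ℕ} (p q s₁ s₂ : ℝ) (label : Fin n → Fin C)
    (f : VertexPair n → Bool → Bool → Bool → ℝ) :
    ∑ ω : Bits n, ω.mass p q s₁ s₂ label * ∏ e, f e (ω.edge e) (ω.keep₁ e) (ω.keep₂ e) =
      ∏ e, ∑ t : Bool × Bool × Bool, bernoulliMass (edgeProb p q label e) t.1 *
        bernoulliMass s₁ t.2.1 * bernoulliMass s₂ t.2.2 * f e t.1 t.2.1 t.2.2 := by
  classical
  rw [Finset.prod_univ_sum, Fintype.piFinset_univ]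
  let E : Bits n ≃ (VertexPair n → Bool × Bool × Bool) :=
    { toFun := fun ω e => (ω.edge e, ω.keep₁ e, ω.keep₂ e)
      invFun := fun t => ⟨fun e => (t e).1, fun e => (t e).2.1, fun e => (t e).2.2⟩
      left_inv := fun _ => rfl
      right_inv := fun _ => rfl }
  refine Fintype.sum_equiv E _ _ fun ω => ?_
  rw [Bits.mass, ← Finset.prod_mul_distrib]
  rfl

theorem Bits.sum_mass {n C : ℕ} (p q s₁ s₂ : ℝ) (label : Fin n → Fin C) :
    ∑ ω : Bits n, ω.mass p q s₁ s₂ label = 1 := by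
  have h := Bits.sum_mass_mul_prod p q s₁ s₂ label fun _ _ _ _ => 1
  simp only [Finset.prod_const_one, mul_one] at h
  rw [h]
  refine Finset.prod_eq_one fun e _ => ?_
  simp only [Fintype.sum_prod_type, Fintype.sum_bool, bernoulliMass]
  simp
  ring

/-- The pairs of `S` are all edges of the underlying graph with probability at most `P ^ |S|`. -/
theorem Bits.sum_mass_mul_edges_le {n C : ℕ} {p q s₁ s₂ P : ℝ} (hp : p ∈ Set.Icc 0 P)
    (hq : q ∈ Set.Icc 0 P) (label : Fin n → Fin C) (S : Finset (VertexPair n)) :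
    ∑ ω : Bits n, ω.mass p q s₁ s₂ label * ∏ e, (if e ∈ S → ω.edge e = true then (1 : ℝ) else 0) ≤
      P ^ S.card := by
  classical
  rw [Bits.sum_mass_mul_prod p q s₁ s₂ label fun e x _ _ => if e ∈ S → x = true then (1 : ℝ) else 0]
  have h : ∀ e : VertexPair n, (∑ t : Bool × Bool × Bool,
      bernoulliMass (edgeProb p q label e) t.1 * bernoulliMass s₁ t.2.1 * bernoulliMass s₂ t.2.2 *
        (if e ∈ S → t.1 = true then (1 : ℝ) else 0)) =
      if e ∈ S then edgeProb p q label e else 1 := by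
    intro e
    simp only [Fintype.sum_prod_type, Fintype.sum_bool, bernoulliMass]
    by_cases he : e ∈ S <;> simp [he] <;> ring
  simp only [h]
  rw [Finset.prod_ite_mem, Finset.univ_inter, ← Finset.prod_const]
  exact Finset.prod_le_prod (fun e _ => (edgeProb_mem hp hq label e).1)
    fun e _ => (edgeProb_mem hp hq label e).2

open Classical in
/-- The pairs at `v` that are edges of both subsampled graphs. -/
noncomputable def commonPairs {n : ℕ} (ω : Bits n) (v : Fin n) : Finset (VertexPair n) :=
  Finset.univ.filter fun e => v ∈ e.1 ∧ ω.edge e = true ∧ ω.keep₁ e = true ∧ ω.keep₂ e = true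

theorem card_commonPairs_le {n : ℕ} (ω : Bits n) (v : Fin n) :
    (commonPairs ω v).card ≤ (commonNeighbors ω.G₁ ω.G₂ id v).card := by
  classical
  have h : (commonPairs ω v).map (Function.Embedding.subtype _) ⊆
      (commonNeighbors ω.G₁ ω.G₂ id v).image fun u => s(v, u) := by
    intro e he
    simp only [commonPairs, Finset.mem_map, Finset.mem_filter, Finset.mem_univ, true_and,
      Function.Embedding.subtype_apply] at he
    obtain ⟨⟨e, hd⟩, ⟨⟨u, rfl⟩, h1, h2, h3⟩, rfl⟩ := he
    rw [Finset.mem_image]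
    refine ⟨u, ?_, rfl⟩
    simp only [commonNeighbors, Finset.mem_filter, Finset.mem_univ, true_and, Bits.G₁, Bits.G₂,
      graphOf_adj, id, Bool.and_eq_true]
    exact ⟨⟨hd, h1, h2⟩, ⟨hd, h1, h3⟩⟩
  rw [← Finset.card_map (Function.Embedding.subtype _)]
  exact (Finset.card_le_card h).trans Finset.card_image_le

theorem sum_edgeProb {n C : ℕ} (p q : ℝ) (label : Fin n → Fin C) (v : Fin n) :
    ∑ e ∈ pairsMeeting {v}, edgeProb p q label e =
      ∑ u ∈ Finset.univ.erase v, if label u = label v then p else q := by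
  classical
  symm
  have hne : ∀ u ∈ (Finset.univ : Finset (Fin n)).erase v, ¬ (s(v, u)).IsDiag := by
    intro u hu
    rw [Sym2.mk_isDiag_iff]
    exact (Finset.ne_of_mem_erase hu).symm
  refine Finset.sum_bij (fun u hu => (⟨s(v, u), hne u hu⟩ : VertexPair n)) ?_ ?_ ?_ ?_
  · intro u hu
    simp [pairsMeeting]
  · intro u _ u' _ h
    exact Sym2.congr_right.mp (congrArg Subtype.val h)
  · rintro ⟨e, hd⟩ he
    simp only [pairsMeeting, Finset.mem_filter, Finset.mem_univ, true_and,
      Finset.mem_singleton, exists_eq_left] at he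
    obtain ⟨u, rfl⟩ := he
    refine ⟨u, ?_, rfl⟩
    rw [Finset.mem_erase]
    exact ⟨fun h => hd (Sym2.mk_isDiag_iff.mpr h.symm), Finset.mem_univ _⟩
  · intro u hu
    simp only [edgeProb, Sym2.map_mk, Sym2.mk_isDiag_iff]
    exact if_congr eq_comm rfl rfl

/-- Chernoff's bound for the expectation of `(1 / 4) ^ d`, where `d` is the degree of `v` in the
graph of common edges. -/
theorem Bits.sum_mass_mul_degree_le {n C : ℕ} {p q s₁ s₂ : ℝ} (hp : p ∈ Set.Icc (0 : ℝ) 1)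
    (hq : q ∈ Set.Icc (0 : ℝ) 1) (hs₁ : s₁ ∈ Set.Icc (0 : ℝ) 1) (hs₂ : s₂ ∈ Set.Icc (0 : ℝ) 1)
    (label : Fin n → Fin C) (v : Fin n) :
    ∑ ω : Bits n, ω.mass p q s₁ s₂ label * (1 / 4) ^ (commonPairs ω v).card ≤
      Real.exp (-(3 / 4 * (s₁ * s₂) *
        ∑ u ∈ Finset.univ.erase v, if label u = label v then p else q)) := by
  classical
  have hpow : ∀ ω : Bits n, ((1 : ℝ) / 4) ^ (commonPairs ω v).card =
      ∏ e : VertexPair n, if v ∈ e.1 ∧ ω.edge e = true ∧ ω.keep₁ e = true ∧ ω.keep₂ e = true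
        then (1 : ℝ) / 4 else 1 := by
    intro ω
    rw [Finset.prod_ite, Finset.prod_const, Finset.prod_const_one, mul_one, commonPairs]
  simp only [hpow]
  rw [Bits.sum_mass_mul_prod p q s₁ s₂ label fun e x y z =>
    if v ∈ e.1 ∧ x = true ∧ y = true ∧ z = true then (1 : ℝ) / 4 else 1]
  have h : ∀ e : VertexPair n, (∑ t : Bool × Bool × Bool,
      bernoulliMass (edgeProb p q label e) t.1 * bernoulliMass s₁ t.2.1 * bernoulliMass s₂ t.2.2 *
        (if v ∈ e.1 ∧ t.1 = true ∧ t.2.1 = true ∧ t.2.2 = true then (1 : ℝ) / 4 else 1)) =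
      if e ∈ pairsMeeting {v} then 1 - 3 / 4 * (s₁ * s₂) * edgeProb p q label e else 1 := by
    intro e
    simp only [Fintype.sum_prod_type, Fintype.sum_bool, bernoulliMass, pairsMeeting,
      Finset.mem_filter, Finset.mem_univ, true_and, Finset.mem_singleton, exists_eq_left]
    by_cases he : v ∈ e.1 <;> simp [he] <;> ring
  simp only [h]
  rw [Finset.prod_ite_mem, Finset.univ_inter, ← sum_edgeProb, Finset.mul_sum,
    ← Finset.sum_neg_distrib, Real.exp_sum]
  refine Finset.prod_le_prod (fun e _ => ?_) fun e _ => Real.one_sub_le_exp_neg _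
  have he := edgeProb_mem hp hq label e
  have h1 : s₁ * s₂ * edgeProb p q label e ≤ 1 :=
    mul_le_one₀ (mul_le_one₀ hs₁.2 hs₂.1 hs₂.2) he.1 he.2
  linarith

/-! ### The union bound -/

open Classical in
/-- The union bound in terms of indicators: the search outputs `π`, or some vertex has degree less
than `31` in the graph of common edges, or some set of pairs witnesses a false matching. -/
theorem one_le_success_add {n C : ℕ} (ω : Bits n) (label : Fin n → Fin C)
    (π : Equiv.Perm (Fin n)) :
    (1 : ℝ) ≤ (if coreMatching 31 (observation ω.G₁ ω.G₂ label π) = funCode π then 1 else 0) +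
      (∑ v, 4 ^ 31 * (1 / 4) ^ (commonPairs ω v).card +
        ∑ τ ∈ (Finset.univ : Finset (Equiv.Perm (Fin n))).erase 1, ∑ S ∈ witnessSets τ,
          ∏ e, if e ∈ S ∪ S.image (pairPerm τ) → ω.edge e = true then (1 : ℝ) else 0) := by
  have hA : ∀ v, (0 : ℝ) ≤ 4 ^ 31 * (1 / 4) ^ (commonPairs ω v).card := fun v => by positivity
  have hB : ∀ (τ : Equiv.Perm (Fin n)) (S : Finset (VertexPair n)), (0 : ℝ) ≤
      ∏ e, if e ∈ S ∪ S.image (pairPerm τ) → ω.edge e = true then (1 : ℝ) else 0 :=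
    fun τ S => Finset.prod_nonneg fun e _ => by split_ifs <;> norm_num
  have hA' := Finset.sum_nonneg fun v (_ : v ∈ (Finset.univ : Finset (Fin n))) => hA v
  have hB' := Finset.sum_nonneg fun τ
    (_ : τ ∈ (Finset.univ : Finset (Equiv.Perm (Fin n))).erase 1) =>
      Finset.sum_nonneg fun S (_ : S ∈ witnessSets τ) => hB τ S
  by_cases hdeg : ∀ v, 31 ≤ (commonNeighbors ω.G₁ ω.G₂ id v).card
  · by_cases hfalse : ∀ τ : Equiv.Perm (Fin n), τ ≠ 1 →
        ∃ v, (commonNeighbors ω.G₁ ω.G₂ τ v).card < 31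
    · rw [if_pos (coreMatching_observation label π hdeg hfalse)]
      linarith
    · push Not at hfalse
      obtain ⟨τ, hτ, hv⟩ := hfalse
      obtain ⟨S, hS, hSe⟩ := exists_witnessSet ω τ hv
      have h1 : (∏ e, if e ∈ S ∪ S.image (pairPerm τ) → ω.edge e = true
          then (1 : ℝ) else 0) = 1 := by
        refine Finset.prod_eq_one fun e _ => if_pos fun he => ?_
        rcases Finset.mem_union.mp he with he | he
        · exact (hSe e he).1
        · obtain ⟨e', he', rfl⟩ := Finset.mem_image.mp he
          exact (hSe e' he').2
      have h2 := Finset.single_le_sum (fun S (_ : S ∈ witnessSets τ) => hB τ S) hS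
      have h3 := Finset.single_le_sum (fun τ
        (_ : τ ∈ (Finset.univ : Finset (Equiv.Perm (Fin n))).erase 1) =>
          Finset.sum_nonneg fun S (_ : S ∈ witnessSets τ) => hB τ S)
        (Finset.mem_erase.mpr ⟨hτ, Finset.mem_univ τ⟩)
      simp only [h1] at h2
      split_ifs <;> linarith
  · push Not at hdeg
    obtain ⟨v, hv⟩ := hdeg
    have h1 : (1 : ℝ) ≤ 4 ^ 31 * (1 / 4) ^ (commonPairs ω v).card := by
      have h2 : ((1 : ℝ) / 4) ^ 31 ≤ (1 / 4) ^ (commonPairs ω v).card :=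
        pow_le_pow_of_le_one (by norm_num) (by norm_num)
          ((card_commonPairs_le ω v).trans hv.le)
      calc (1 : ℝ) = 4 ^ 31 * (1 / 4) ^ 31 := by norm_num
        _ ≤ _ := by gcongr
    have h3 := Finset.single_le_sum (fun v (_ : v ∈ (Finset.univ : Finset (Fin n))) => hA v)
      (Finset.mem_univ v)
    split_ifs <;> linarith

theorem one_sub_le_recoveryProb {n C : ℕ} {p q s₁ s₂ P : ℝ} (hp : p ∈ Set.Icc 0 P)
    (hq : q ∈ Set.Icc 0 P) (hP : P ≤ 1) (hs₁ : s₁ ∈ Set.Icc (0 : ℝ) 1)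
    (hs₂ : s₂ ∈ Set.Icc (0 : ℝ) 1) (hn : ((n : ℝ) ^ 8 * P ^ 10) ≤ 1) (label : Fin n → Fin C) :
    1 - (∑ v, 4 ^ 31 * Real.exp (-(3 / 4 * (s₁ * s₂) *
        ∑ u ∈ Finset.univ.erase v, if label u = label v then p else q)) +
        n * ((n : ℝ) ^ 8 * P ^ 10)) ≤
      recoveryProb (coreMatching 31) p q s₁ s₂ label := by
  classical
  have hp1 : p ∈ Set.Icc (0 : ℝ) 1 := ⟨hp.1, hp.2.trans hP⟩
  have hq1 : q ∈ Set.Icc (0 : ℝ) 1 := ⟨hq.1, hq.2.trans hP⟩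
  have hP0 : 0 ≤ P := hp.1.trans hp.2
  set W : Bits n → ℝ := fun ω => ω.mass p q s₁ s₂ label with hW
  have hW0 : ∀ ω, 0 ≤ W ω := fun ω => Bits.mass_nonneg hp1 hq1 hs₁ hs₂ label ω
  -- the part of the failure that does not depend on `π`
  set R : Bits n → ℝ := fun ω => ∑ v, 4 ^ 31 * (1 / 4) ^ (commonPairs ω v).card +
        ∑ τ ∈ (Finset.univ : Finset (Equiv.Perm (Fin n))).erase 1, ∑ S ∈ witnessSets τ,
          ∏ e, if e ∈ S ∪ S.image (pairPerm τ) → ω.edge e = true then (1 : ℝ) else 0 with hR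
  have hfact : (n.factorial : ℝ) ≠ 0 := by exact_mod_cast n.factorial_ne_zero
  have hsum : ∑ _π : Equiv.Perm (Fin n), (1 / (n.factorial : ℝ)) = 1 := by
    rw [Finset.sum_const, Finset.card_univ, Fintype.card_perm, Fintype.card_fin, nsmul_eq_mul]
    field_simp
  have hlow : ∑ ω, W ω * (1 - R ω) ≤ recoveryProb (coreMatching 31) p q s₁ s₂ label := by
    unfold recoveryProb
    refine Finset.sum_le_sum fun ω _ => ?_
    calc W ω * (1 - R ω) = ∑ _π : Equiv.Perm (Fin n), W ω * (1 / (n.factorial : ℝ)) * (1 - R ω) := by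
          rw [← Finset.sum_mul, ← Finset.mul_sum, hsum, mul_one]
      _ ≤ _ := by
          refine Finset.sum_le_sum fun π _ => ?_
          have h1 := one_le_success_add ω label π
          refine mul_le_mul_of_nonneg_left ?_ (mul_nonneg (hW0 ω) (by positivity))
          rw [sub_le_iff_le_add]
          convert h1
  have hRsum : ∑ ω, W ω * R ω ≤ ∑ v, 4 ^ 31 * Real.exp (-(3 / 4 * (s₁ * s₂) *
        ∑ u ∈ Finset.univ.erase v, if label u = label v then p else q)) +
        n * ((n : ℝ) ^ 8 * P ^ 10) := by
    simp only [hR, mul_add, Finset.sum_add_distrib, Finset.mul_sum]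
    refine add_le_add ?_ ?_
    · rw [Finset.sum_comm]
      refine Finset.sum_le_sum fun v _ => ?_
      have h1 := Bits.sum_mass_mul_degree_le hp1 hq1 hs₁ hs₂ label v
      calc ∑ ω, W ω * (4 ^ 31 * (1 / 4) ^ (commonPairs ω v).card)
          = 4 ^ 31 * ∑ ω, W ω * (1 / 4) ^ (commonPairs ω v).card := by
            rw [Finset.mul_sum]
            exact Finset.sum_congr rfl fun ω _ => by ring
        _ ≤ _ := by gcongr; rw [Finset.mul_sum] at h1; exact h1
    · rw [Finset.sum_comm]
      have hτ : ∀ τ ∈ (Finset.univ : Finset (Equiv.Perm (Fin n))).erase 1,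
          ∑ ω, ∑ S ∈ witnessSets τ, W ω *
            (∏ e, if e ∈ S ∪ S.image (pairPerm τ) → ω.edge e = true then (1 : ℝ) else 0) ≤
          ((n : ℝ) ^ 6 * P ^ 10) ^ τ.support.card := by
        intro τ _
        rw [Finset.sum_comm]
        have hS : ∀ S ∈ witnessSets τ, ∑ ω, W ω *
            (∏ e, if e ∈ S ∪ S.image (pairPerm τ) → ω.edge e = true then (1 : ℝ) else 0) ≤
            (P ^ 10) ^ τ.support.card := by
          intro S hS
          rw [witnessSets, Finset.mem_filter, Finset.mem_powersetCard] at hS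
          have hcard : (S ∪ S.image (pairPerm τ)).card = 10 * τ.support.card := by
            rw [Finset.card_union_of_disjoint (by convert hS.2),
              Finset.card_image_of_injective _ (pairPerm_injective τ), hS.1.2]
            ring
          have h1 := Bits.sum_mass_mul_edges_le (s₁ := s₁) (s₂ := s₂) hp hq label
            (S ∪ S.image (pairPerm τ))
          rw [hcard, pow_mul] at h1
          refine le_of_eq_of_le (Finset.sum_congr rfl fun ω _ => ?_) h1
          congr!
        calc _ ≤ ∑ _S ∈ witnessSets τ, (P ^ 10) ^ τ.support.card := Finset.sum_le_sum hS
          _ = (witnessSets τ).card * (P ^ 10) ^ τ.support.card := by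
            rw [Finset.sum_const, nsmul_eq_mul]
          _ ≤ ((n : ℝ) ^ 6) ^ τ.support.card * (P ^ 10) ^ τ.support.card := by
            gcongr
            exact_mod_cast card_witnessSets_le τ
          _ = _ := by rw [mul_pow]
      refine (Finset.sum_le_sum hτ).trans ?_
      have heq : (n : ℝ) ^ 2 * ((n : ℝ) ^ 6 * P ^ 10) = (n : ℝ) ^ 8 * P ^ 10 := by ring
      have h2 := sum_pow_card_support_le (n := n) (x := (n : ℝ) ^ 6 * P ^ 10) (by positivity)
        (by rw [heq]; exact hn)
      rwa [heq] at h2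
  calc _ ≤ 1 - ∑ ω, W ω * R ω := by linarith
    _ = ∑ ω, W ω * (1 - R ω) := by
      simp only [mul_sub, mul_one, Finset.sum_sub_distrib]
      rw [show ∑ ω, W ω = 1 from Bits.sum_mass p q s₁ s₂ label]
    _ ≤ _ := hlow

/-! ### Asymptotics -/

theorem EquallySized.card_mul {n C : ℕ} {label : Fin n → Fin C} (h : EquallySized label)
    (k : Fin C) : (C : ℝ) * (Finset.univ.filter fun u => label u = k).card = n := by
  have hk : ∀ k' : Fin C, (Finset.univ.filter fun u => label u = k').card =
      (Finset.univ.filter fun u => label u = k).card := by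
    intro k'
    have := h k' k
    rwa [Nat.card_eq_fintype_card, Nat.card_eq_fintype_card, Fintype.card_subtype,
      Fintype.card_subtype] at this
  have h1 := Finset.card_eq_sum_card_fiberwise (f := label) (s := Finset.univ)
    (t := Finset.univ) (fun _ _ => Finset.mem_coe.mpr (Finset.mem_univ _))
  rw [Finset.sum_congr rfl fun k' _ => hk k', Finset.sum_const, Finset.card_univ, Finset.card_univ,
    Fintype.card_fin, Fintype.card_fin, smul_eq_mul] at h1
  exact_mod_cast h1.symm

/-- The expected degree of `v` when a pair is an edge with probability `p` inside a community and
`q` between communities. -/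
theorem EquallySized.sum_erase {n C : ℕ} {label : Fin n → Fin C} (h : EquallySized label)
    (p q : ℝ) (v : Fin n) :
    (∑ u ∈ Finset.univ.erase v, if label u = label v then p else q) =
      n / C * p + (n - n / C) * q - p := by
  have hC : (C : ℝ) ≠ 0 := by
    have := (label v).pos
    positivity
  have h1 := Finset.add_sum_erase Finset.univ (fun u => if label u = label v then p else q)
    (Finset.mem_univ v)
  have h2 : (∑ u, if label u = label v then p else q) =
      ∑ u, (q + if label u = label v then p - q else 0) :=
    Finset.sum_congr rfl fun u _ => by split_ifs <;> ring
  have h3 : ((Finset.univ.filter fun u => label u = label v).card : ℝ) = n / C := by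
    rw [eq_div_iff hC, mul_comm]
    exact h.card_mul _
  rw [h2, Finset.sum_add_distrib, ← Finset.sum_filter, Finset.sum_const, Finset.sum_const,
    nsmul_eq_mul, nsmul_eq_mul, h3, Finset.card_univ, Fintype.card_fin, if_pos rfl] at h1
  linear_combination h1

theorem tendsto_failure_bound (a M : ℝ) :
    Tendsto (fun n : ℕ => 4 ^ 31 * Real.exp a * Real.exp (-(1 / 2 * Real.log n)) +
      M ^ 10 * (Real.log n ^ 10 / n)) atTop (nhds 0) := by
  have h1 : Tendsto (fun n : ℕ => Real.log n) atTop atTop :=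
    Real.tendsto_log_atTop.comp tendsto_natCast_atTop_atTop
  have h2 : Tendsto (fun n : ℕ => Real.exp (-(1 / 2 * Real.log n))) atTop (nhds 0) :=
    Real.tendsto_exp_neg_atTop_nhds_zero.comp (h1.const_mul_atTop (by norm_num))
  have h3 : Tendsto (fun n : ℕ => Real.log n ^ 10 / (n : ℝ)) atTop (nhds 0) :=
    (Real.isLittleO_pow_log_id_atTop (n := 10)).tendsto_div_nhds_zero.comp
      tendsto_natCast_atTop_atTop
  simpa using (h2.const_mul (4 ^ 31 * Real.exp a)).add (h3.const_mul (M ^ 10))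

theorem mainTheorem2 (C : ℕ) (hC : 1 ≤ C) (a b s₁ s₂ : ℝ) (ha : 0 ≤ a) (hb : 0 ≤ b)
    (hs₁ : s₁ ∈ Set.Icc (0 : ℝ) 1) (hs₂ : s₂ ∈ Set.Icc (0 : ℝ) 1)
    (h : (a + ((C : ℝ) - 1) * b) * s₁ * s₂ / (C : ℝ) > 2) :
    ∃ A : List (List Bool) × List (List Bool) × List ℕ × List ℕ → List ℕ,
      Computable A ∧
      ∀ ε : ℝ, 0 < ε → ∀ᶠ n : ℕ in atTop, ∀ label : Fin n → Fin C, EquallySized label →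
        recoveryProb A (a * Real.log n / n) (b * Real.log n / n) s₁ s₂ label ≥ 1 - ε := by
  refine ⟨coreMatching 31, computable_coreMatching 31, fun ε hε => ?_⟩
  have hP : Tendsto (fun n : ℕ => (a + b) * (Real.log n ^ 1 / n)) atTop (nhds 0) := by
    simpa using ((Real.isLittleO_pow_log_id_atTop (n := 1)).tendsto_div_nhds_zero.comp
      tendsto_natCast_atTop_atTop).const_mul (a + b)
  filter_upwards [(tendsto_failure_bound a (a + b)).eventually_le_const (lt_min one_pos hε),
    hP.eventually_le_const one_pos, eventually_ge_atTop 1] with n hn hP1 hn1 label hlabel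
  have hC0 : (C : ℝ) ≠ 0 := by positivity
  have hnpos : (0 : ℝ) < n := by exact_mod_cast hn1
  have hn1' : (1 : ℝ) ≤ n := by exact_mod_cast hn1
  set l := Real.log n with hl
  have hl0 : 0 ≤ l := Real.log_nonneg hn1'
  have hln : l ≤ n := (Real.log_le_sub_one_of_pos hnpos).trans (by linarith)
  set P : ℝ := (a + b) * l / n with hPdef
  have hp : a * l / n ∈ Set.Icc 0 P :=
    ⟨by positivity, by rw [hPdef]; gcongr; linarith⟩
  have hq : b * l / n ∈ Set.Icc 0 P :=
    ⟨by positivity, by rw [hPdef]; gcongr; linarith⟩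
  have hP1' : P ≤ 1 := by rw [hPdef, mul_div_assoc]; simpa using hP1
  have hP0 : 0 ≤ P := by positivity
  have hfalse : n * ((n : ℝ) ^ 8 * P ^ 10) = (a + b) ^ 10 * (l ^ 10 / n) := by
    rw [hPdef]; field_simp
  have hsmall : (n : ℝ) ^ 8 * P ^ 10 ≤ 1 := by
    have h0 : 0 ≤ 4 ^ 31 * Real.exp a * Real.exp (-(1 / 2 * l)) := by positivity
    have h1 : (n : ℝ) ^ 8 * P ^ 10 ≤ n * ((n : ℝ) ^ 8 * P ^ 10) :=
      le_mul_of_one_le_left (by positivity) hn1'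
    have h2 := hn.trans (min_le_left 1 ε)
    linarith
  -- a vertex has mean common degree at least `2 log n - a`, and `3 / 4 * 2 > 1`
  have hdeg : ∀ v : Fin n, 4 ^ 31 * Real.exp (-(3 / 4 * (s₁ * s₂) *
      ∑ u ∈ Finset.univ.erase v, if label u = label v then a * l / n else b * l / n)) ≤
      4 ^ 31 * (Real.exp a * Real.exp (-(3 / 2 * l))) := by
    intro v
    have hmean : (s₁ * s₂) * (n / C * (a * l / n) + (n - n / C) * (b * l / n) - a * l / n) =
        (a + ((C : ℝ) - 1) * b) * s₁ * s₂ / C * l - s₁ * s₂ * (a * (l / n)) := by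
      field_simp
    have h1 : 2 * l ≤ (a + ((C : ℝ) - 1) * b) * s₁ * s₂ / C * l :=
      mul_le_mul_of_nonneg_right h.le hl0
    have h2 : a * (l / n) ≤ a := mul_le_of_le_one_right ha ((div_le_one hnpos).mpr hln)
    have h3 : s₁ * s₂ * (a * (l / n)) ≤ a * (l / n) :=
      mul_le_of_le_one_left (by positivity) (mul_le_one₀ hs₁.2 hs₂.1 hs₂.2)
    rw [← Real.exp_add, hlabel.sum_erase, mul_assoc (3 / 4 : ℝ), hmean]
    gcongr
    linarith
  have hsum : ∑ _v : Fin n, 4 ^ 31 * (Real.exp a * Real.exp (-(3 / 2 * l))) =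
      4 ^ 31 * Real.exp a * Real.exp (-(1 / 2 * l)) := by
    have h1 : (n : ℝ) * Real.exp (-(3 / 2 * l)) = Real.exp (-(1 / 2 * l)) := by
      nth_rewrite 1 [← Real.exp_log hnpos]
      rw [← Real.exp_add, ← hl]
      congr 1
      ring
    rw [Finset.sum_const, Finset.card_univ, Fintype.card_fin, nsmul_eq_mul, ← h1]
    ring
  have hmain := one_sub_le_recoveryProb hp hq hP1' hs₁ hs₂ hsmall label
  have hle := Finset.sum_le_sum fun v (_ : v ∈ (Finset.univ : Finset (Fin n))) => hdeg v
  have hε' := hn.trans (min_le_right 1 ε)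
  rw [hsum] at hle
  rw [hfalse] at hmain
  linarith
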